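/- Let $V=F\cup\{C\}$ be a finite set of discrete random variables, each with finitely many values, where $C$ is the class attribute and $F=\{F_1,\dots,F_n\}$ is the set of features. Let $\langle V,G,P(V)\rangle$ be a Bayesian network: $G$ is a directed acyclic graph with node set $V$, $P(V)$ is a joint distribution of $V$, and the Markov condition holds, i.e. every node is independent of any subset of its non-descendants conditioned on its parents. Assume that $G$ is faithful to $P(V)$: whenever $V_i\ne V_j$ are conditionally independent in $P$ given some $S\subseteq V\setminus\{V_i,V_j\}$, this conditional independence is entailed by $G$ and the Markov condition, i.e. it holds in every joint distribution of finitely valued variables indexed by the nodes of $G$ that satisfies the Markov condition with respect to $G$. Let $MB(C)$, the Markov blanket of $C$, be the set of the parents, the children and the spouses (other parents of the children) of $C$ in $G$. Call $F_i\in F$ strongly relevant to $C$ (in the sense of Kohavi and John) if there are values $f=(f_1,\dots,f_n)$ of the features and a value $c$ of $C$ such that $P(F=f)>0$ and $P(C=c\mid F=f)\ne P(C=c\mid F\setminus\{F_i\}=(f_1,\dots,f_{i-1},f_{i+1},\dots,f_n))$. Then for every $F_i\in F$: $F_i\in MB(C)$ if and only if $F_i$ is strongly relevant to $C$; and $F_i$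 is strongly relevant to $C$ if and only if $I(F_i;C\mid F\setminus\{F_i\})>0$, where $I(X;Y\mid Z)=\sum_z P(z)\sum_{x,y}P(x,y\mid z)\log\frac{P(x,y\mid z)}{P(x\mid z)P(y\mid z)}$. Consequently $MB(C)$ is exactly the set of the features that are strongly relevant to $C$, so the targets of causal and of non-causal feature selection coincide. -/

import Mathlib

open Finset

noncomputable section

/-! ### Discrete random variables on a probability space given by a mass function -/

namespace DiscreteProb

variable {Ω : Type*} {X Y Z : Type*}

/-- The probability `P(E)` of an event. -/
def prob (P : PMF Ω) (E : Set Ω) : ℝ := (P.toOuterMeasure E).toReal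

/-- The conditional probability `P(E | D)`; it is used only where `P(D) > 0`. -/
def condProb (P : PMF Ω) (E D : Set Ω) : ℝ := prob P (E ∩ D) / prob P D

/-- Conditional independence of random variables `f`, `g` given `h`:
`P(f, g | h) = P(f | h) P(g | h)` for all values, whenever the conditioning event is not null. -/
def CondIndep (P : PMF Ω) (f : Ω → X) (g : Ω → Y) (h : Ω → Z) : Prop :=
  ∀ x y z, 0 < prob P {ω | h ω = z} →
    condProb P {ω | f ω = x ∧ g ω = y} {ω | h ω = z} =
      condProb P {ω | f ω = x} {ω | h ω = z} * condProb P {ω | g ω = y} {ω | h ω = z}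

/-- The conditional mutual information
`I(f; g | h) = ∑_z P(z) ∑_{x, y} P(x, y | z) log (P(x, y | z) / (P(x | z) P(y | z)))`.
Terms with `P(z) = 0` or `P(x, y | z) = 0` are zero. -/
def condMutualInfo [Fintype X] [Fintype Y] [Fintype Z]
    (P : PMF Ω) (f : Ω → X) (g : Ω → Y) (h : Ω → Z) : ℝ :=
  ∑ z, prob P {ω | h ω = z} *
    ∑ x, ∑ y, condProb P {ω | f ω = x ∧ g ω = y} {ω | h ω = z} *
      Real.log (condProb P {ω | f ω = x ∧ g ω = y} {ω | h ω = z} /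
        (condProb P {ω | f ω = x} {ω | h ω = z} * condProb P {ω | g ω = y} {ω | h ω = z}))

end DiscreteProb

/-! ### Directed acyclic graphs -/

namespace BayesNet

open DiscreteProb

variable {V : Type*}

/-- A directed graph without directed cycles (in particular without loops). -/
def IsAcyclic (G : Digraph V) : Prop := ∀ v, ¬ Relation.TransGen G.Adj v v

/-- `w` is a descendant of `v`: there is a directed path of length at least one from `v`. -/
def IsDescendant (G : Digraph V) (v w : V) : Prop := Relation.TransGen G.Adj v w

section Neighbourhoods

variable [Fintype V]

open Classical in
/-- The parents of `v`. -/
def parents (G : Digraph V) (v : V) : Finset V := {u | G.Adj u v}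

open Classical in
/-- The children of `v`. -/
def children (G : Digraph V) (v : V) : Finset V := {w | G.Adj v w}

open Classical in
/-- The spouses of `v`: the other parents of the children of `v`. -/
def spouses (G : Digraph V) (v : V) : Finset V := {u | u ≠ v ∧ ∃ w ∈ children G v, G.Adj u w}

open Classical in
/-- The Markov blanket of `v`: its parents, children and spouses. -/
def markovBlanket (G : Digraph V) (v : V) : Finset V :=
  parents G v ∪ children G v ∪ spouses G v

/-! ### Bayesian networks

A joint distribution of the variables `v : V`, with values in `α v`, is a `PMF` on assignments
`(v : V) → α v`. The random variable of `v` is the coordinate `fun ω ↦ ω v`, and the random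
vector of a set `S` of variables is `S.restrict`. -/

/-- The Markov condition: every node is independent of any subset of its non-descendants
(the node itself not counted among them) conditioned on its parents. -/
def MarkovCondition {α : V → Type*} (G : Digraph V) (P : PMF ((v : V) → α v)) : Prop :=
  ∀ (v : V) (S : Finset V), (∀ w ∈ S, w ≠ v ∧ ¬ IsDescendant G v w) →
    CondIndep P (fun ω ↦ ω v) (S.restrict (π := α)) ((parents G v).restrict (π := α))

/-- The conditional independence of `i` and `j` given `S` is entailed by `G` and the Markov
condition: it holds in every joint distribution of finitely valued variables, indexed by the
nodes of `G`, that satisfies the Markov condition. -/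
def Entails (G : Digraph V) (i j : V) (S : Finset V) : Prop :=
  ∀ (β : V → Type) [∀ v, Finite (β v)] (Q : PMF ((v : V) → β v)), MarkovCondition G Q →
    CondIndep Q (fun ω ↦ ω i) (fun ω ↦ ω j) (S.restrict (π := β))

/-- A Bayesian network: a directed acyclic graph together with a joint distribution of its
nodes for which the Markov condition holds. -/
structure BayesianNetwork (V : Type*) [Fintype V] (α : V → Type*) where
  graph : Digraph V
  acyclic : IsAcyclic graph
  dist : PMF ((v : V) → α v)
  markov : MarkovCondition graph dist

/-- Faithfulness: every conditional independence of two distinct variables given a set of other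
variables that is present in the distribution is entailed by the graph and the Markov
condition. -/
def BayesianNetwork.Faithful {α : V → Type*} (B : BayesianNetwork V α) : Prop :=
  ∀ (i j : V) (S : Finset V), i ≠ j → i ∉ S → j ∉ S →
    CondIndep B.dist (fun ω ↦ ω i) (fun ω ↦ ω j) (S.restrict (π := α)) →
      Entails B.graph i j S

/-! ### Feature relevance -/

variable [DecidableEq V]

/-- The features: all variables except the class attribute `C`. -/
def features (C : V) : Finset V := univ.erase C

/-- The feature `i` is strongly relevant to `C`: there are values `f` of the features and `c` of
`C` such that `P(F = f) > 0` and `P(C = c | F = f) ≠ P(C = c | F ∖ {i} = f restricted)`. -/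
def StronglyRelevant {α : V → Type*} (P : PMF ((v : V) → α v)) (C i : V) : Prop :=
  ∃ (f : (v : features C) → α v) (c : α C),
    0 < prob P {ω | (features C).restrict ω = f} ∧
    condProb P {ω | ω C = c} {ω | (features C).restrict ω = f} ≠
      condProb P {ω | ω C = c}
        {ω | ((features C).erase i).restrict ω = restrict₂ (erase_subset i (features C)) f}

/-- `I(F_i; C | F ∖ {F_i})`. -/
def featureInfo {α : V → Type*} [∀ v, Fintype (α v)]
    (P : PMF ((v : V) → α v)) (C i : V) : ℝ :=
  condMutualInfo P (fun ω ↦ ω i) (fun ω ↦ ω C) (((features C).erase i).restrict (π := α))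

end Neighbourhoods

end BayesNet

end

/-!
Write `i ⊥ C` for the independence of the feature `i` and the class `C` given all other features.
Both strong relevance and positivity of the conditional mutual information say that `i ⊥ C` fails:
the former by rewriting conditional independence as an identity of unconditional probabilities
(`condIndep_iff`, `stronglyRelevant_iff`), the latter by Gibbs' inequality with its equality case
(`condMutualInfo_pos_iff`). It remains to see that `i ⊥ C` holds exactly outside the Markov blanket.

* Outside the blanket: by the Markov condition the joint distribution is the product over the nodes
  of their conditional probabilities given their parents (`MarkovCondition.prob_eq_prod`). The
  factors containing `C` are those of `C` and its children, and apart from `C` they contain only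
  nodes of the blanket, so that the joint distribution splits as a function of `x_i` times a function of
  `x_C`, the other values being fixed.
* Inside the blanket: by faithfulness it is enough to exhibit one distribution with the Markov
  condition in which `i ⊥ C` fails. If `i` and `C` are adjacent, let both equal one fair coin
  (`markovCondition_copy`). If they have a common child, let them be independent fair coins and let
  the child be their exclusive or (`markovCondition_xor`). All other nodes are constant. In both
  cases `i` and `C` agree whenever all other nodes vanish, without being determined.
-/

open DiscreteProb BayesNet

/-! ### Probabilities and conditional independence -/

namespace DiscreteProb

variable {Ω Ω' X Y Z W : Type*}

lemma prob_nonneg (P : PMF Ω) (E : Set Ω) : 0 ≤ prob P E := ENNReal.toReal_nonneg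

lemma toOuterMeasure_ne_top (P : PMF Ω) (E : Set Ω) : P.toOuterMeasure E ≠ ⊤ := by
  rw [PMF.toOuterMeasure_apply]
  exact ne_top_of_le_ne_top P.tsum_coe_ne_top
    (ENNReal.tsum_le_tsum fun ω ↦ Set.indicator_le_self' (fun _ _ ↦ zero_le) ω)

lemma prob_mono (P : PMF Ω) {E D : Set Ω} (h : E ⊆ D) : prob P E ≤ prob P D :=
  ENNReal.toReal_mono (toOuterMeasure_ne_top P D) (P.toOuterMeasure.mono h)

lemma prob_eq_zero_of_subset (P : PMF Ω) {E D : Set Ω} (h : E ⊆ D) (hD : prob P D = 0) :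
    prob P E = 0 :=
  le_antisymm (hD ▸ prob_mono P h) (prob_nonneg P E)

lemma prob_univ (P : PMF Ω) : prob P Set.univ = 1 := by
  simp [prob, PMF.toOuterMeasure_apply, P.tsum_coe]

lemma nonempty_of_prob_pos {P : PMF Ω} {E : Set Ω} (h : 0 < prob P E) : E.Nonempty := by
  rw [Set.nonempty_iff_ne_empty]
  rintro rfl
  simp [prob] at h

lemma prob_map (P : PMF Ω) (φ : Ω → Ω') (E : Set Ω') :
    prob (P.map φ) E = prob P (φ ⁻¹' E) := by
  simp [prob, PMF.toOuterMeasure_map_apply]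

lemma prob_eq_sum_inter [Fintype X] (P : PMF Ω) (f : Ω → X) (E : Set Ω) :
    prob P E = ∑ x, prob P ({ω | f ω = x} ∩ E) := by
  classical
  unfold prob
  rw [← ENNReal.toReal_sum fun x _ ↦ toOuterMeasure_ne_top P _]
  congr 1
  simp only [PMF.toOuterMeasure_apply]
  rw [← Summable.tsum_finsetSum fun _ _ ↦ ENNReal.summable]
  refine tsum_congr fun ω ↦ ?_
  by_cases hω : ω ∈ E <;> simp [Set.indicator_apply, hω]

/-- Conditional independence as an identity of unconditional probabilities; it needs no
positivity, since both sides vanish on a null conditioning event. -/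
lemma condIndep_iff (P : PMF Ω) (f : Ω → X) (g : Ω → Y) (h : Ω → Z) :
    CondIndep P f g h ↔ ∀ x y z,
      prob P {ω | f ω = x ∧ g ω = y ∧ h ω = z} * prob P {ω | h ω = z} =
        prob P {ω | f ω = x ∧ h ω = z} * prob P {ω | g ω = y ∧ h ω = z} := by
  have key (x y z) : {ω | f ω = x ∧ g ω = y} ∩ {ω | h ω = z}
      = {ω | f ω = x ∧ g ω = y ∧ h ω = z} := by ext; simp [and_assoc]
  refine forall_congr' fun x ↦ forall_congr' fun y ↦ forall_congr' fun z ↦ ?_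
  unfold condProb
  rw [key, ← Set.ofPred_and, ← Set.ofPred_and]
  rcases (prob_nonneg P {ω | h ω = z}).eq_or_lt' with h0 | h0
  · have : prob P {ω | f ω = x ∧ h ω = z} = 0 :=
      prob_eq_zero_of_subset P (fun ω hω ↦ hω.2) h0
    simp [h0, this]
  · simp only [h0, true_imp_iff]
    field_simp

lemma condIndep_map (P : PMF Ω) (φ : Ω → Ω') (f : Ω' → X) (g : Ω' → Y) (h : Ω' → Z) :
    CondIndep (P.map φ) f g h ↔ CondIndep P (f ∘ φ) (g ∘ φ) (h ∘ φ) := by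
  simp only [condIndep_iff, prob_map]
  rfl

lemma condIndep_of_comp (P : PMF Ω) {f : Ω → X} (g : Ω → Y) {h : Ω → Z} (F : Z → X)
    (hf : ∀ ω, f ω = F (h ω)) : CondIndep P f g h := by
  rw [condIndep_iff]
  intro x y z
  by_cases hx : F z = x
  · have h1 : {ω | f ω = x ∧ g ω = y ∧ h ω = z} = {ω | g ω = y ∧ h ω = z} := by
      ext ω; simp only [hf, Set.mem_ofPred_eq]; grind
    have h2 : {ω | f ω = x ∧ h ω = z} = {ω | h ω = z} := by
      ext ω; simp only [hf, Set.mem_ofPred_eq]; grind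
    rw [h1, h2, mul_comm]
  · have h1 : {ω | f ω = x ∧ g ω = y ∧ h ω = z} = ∅ := by
      ext ω; simp only [hf, Set.mem_ofPred_eq, Set.mem_empty_iff_false]; grind
    have h2 : {ω | f ω = x ∧ h ω = z} = ∅ := by
      ext ω; simp only [hf, Set.mem_ofPred_eq, Set.mem_empty_iff_false]; grind
    rw [h1, h2]
    simp [prob]

/-- If `f` is independent of `k`, it is independent of any function `g` of `k` given any other
function `h` of `k`. -/
lemma condIndep_of_indep [Fintype W] (P : PMF Ω) {f : Ω → X} {g : Ω → Y} {h : Ω → Z}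
    (k : Ω → W) (hk : ∀ x w, prob P {ω | f ω = x ∧ k ω = w} =
      prob P {ω | f ω = x} * prob P {ω | k ω = w})
    (G : W → Y) (hg : ∀ ω, g ω = G (k ω)) (H : W → Z) (hh : ∀ ω, h ω = H (k ω)) :
    CondIndep P f g h := by
  have key (x) (p : W → Prop) : prob P {ω | f ω = x ∧ p (k ω)} =
      prob P {ω | f ω = x} * prob P {ω | p (k ω)} := by
    rw [prob_eq_sum_inter P k, prob_eq_sum_inter P k {ω | p (k ω)}, mul_sum]
    refine sum_congr rfl fun w _ ↦ ?_
    by_cases hw : p w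
    · have h1 : {ω | k ω = w} ∩ {ω | f ω = x ∧ p (k ω)} = {ω | f ω = x ∧ k ω = w} := by
        ext ω; simp only [Set.mem_inter_iff, Set.mem_ofPred_eq]; grind
      have h2 : {ω | k ω = w} ∩ {ω | p (k ω)} = {ω | k ω = w} := by
        ext ω; simp only [Set.mem_inter_iff, Set.mem_ofPred_eq]; grind
      rw [h1, h2, hk]
    · have h1 : {ω | k ω = w} ∩ {ω | f ω = x ∧ p (k ω)} = ∅ := by
        ext ω; simp only [Set.mem_inter_iff, Set.mem_ofPred_eq, Set.mem_empty_iff_false]; grind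
      have h2 : {ω | k ω = w} ∩ {ω | p (k ω)} = ∅ := by
        ext ω; simp only [Set.mem_inter_iff, Set.mem_ofPred_eq, Set.mem_empty_iff_false]; grind
      rw [h1, h2]
      simp [prob]
  rw [condIndep_iff]
  intro x y z
  simp only [hg, hh]
  rw [key x fun w ↦ G w = y ∧ H w = z, key x fun w ↦ H w = z]
  ring

/-! ### Conditional mutual information -/

/-- Pointwise Gibbs inequality, strict away from equality; `s` is the product of the marginals. -/
lemma sub_lt_mul_log_div {p s : ℝ} (hp : 0 ≤ p) (hs : 0 ≤ s) (hps : 0 < p → 0 < s) (hne : p ≠ s) :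
    p - s < p * Real.log (p / s) := by
  rcases hp.eq_or_lt' with rfl | hp
  · simpa using lt_of_le_of_ne hs hne
  · have hs := hps hp
    have h := Real.log_lt_sub_one_of_pos (div_pos hs hp)
      (by rw [Ne, div_eq_one_iff_eq hp.ne']; exact hne.symm)
    rw [← inv_div, Real.log_inv]
    have h2 : p * (s / p - 1) = s - p := by field_simp
    nlinarith [mul_lt_mul_of_pos_left h hp]

lemma sub_le_mul_log_div {p s : ℝ} (hp : 0 ≤ p) (hs : 0 ≤ s) (hps : 0 < p → 0 < s) :
    p - s ≤ p * Real.log (p / s) := by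
  rcases eq_or_ne p s with rfl | hne
  · rcases eq_or_ne p 0 with rfl | h0 <;> simp [*]
  · exact (sub_lt_mul_log_div hp hs hps hne).le

lemma condProb_nonneg (P : PMF Ω) (E D : Set Ω) : 0 ≤ condProb P E D :=
  div_nonneg (prob_nonneg P _) (prob_nonneg P _)

lemma condProb_mono (P : PMF Ω) {E E' : Set Ω} (D : Set Ω) (h : E ⊆ E') :
    condProb P E D ≤ condProb P E' D :=
  div_le_div_of_nonneg_right (prob_mono P (Set.inter_subset_inter_left D h)) (prob_nonneg P D)

lemma sum_condProb_eq_one [Fintype X] (P : PMF Ω) (f : Ω → X) {D : Set Ω} (hD : 0 < prob P D) :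
    ∑ x, condProb P {ω | f ω = x} D = 1 := by
  unfold condProb
  rw [← sum_div, ← prob_eq_sum_inter P f D, div_self hD.ne']

/-- Gibbs' inequality together with its equality case, averaged over the conditioning variable. -/
lemma condMutualInfo_pos_iff [Fintype X] [Fintype Y] [Fintype Z]
    (P : PMF Ω) (f : Ω → X) (g : Ω → Y) (h : Ω → Z) :
    0 < condMutualInfo P f g h ↔ ¬ CondIndep P f g h := by
  constructor
  · intro hpos hci
    refine hpos.ne' (sum_eq_zero fun z _ ↦ ?_)
    rcases (prob_nonneg P {ω | h ω = z}).eq_or_lt' with h0 | h0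
    · simp [h0]
    · refine mul_eq_zero_of_right _ (sum_eq_zero fun x _ ↦ sum_eq_zero fun y _ ↦ ?_)
      rw [← hci x y z h0]
      rcases eq_or_ne (condProb P {ω | f ω = x ∧ g ω = y} {ω | h ω = z}) 0 with h1 | h1 <;>
        simp [h1]
  · intro hci
    simp only [CondIndep, not_forall] at hci
    obtain ⟨x₀, y₀, z₀, hz₀, hne⟩ := hci
    have hs (x y z) : 0 ≤ condProb P {ω | f ω = x} {ω | h ω = z} *
        condProb P {ω | g ω = y} {ω | h ω = z} :=
      mul_nonneg (condProb_nonneg P _ _) (condProb_nonneg P _ _)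
    have hps (x y z) (hp : 0 < condProb P {ω | f ω = x ∧ g ω = y} {ω | h ω = z}) :
        0 < condProb P {ω | f ω = x} {ω | h ω = z} * condProb P {ω | g ω = y} {ω | h ω = z} :=
      mul_pos (hp.trans_le (condProb_mono P _ fun ω hω ↦ hω.1))
        (hp.trans_le (condProb_mono P _ fun ω hω ↦ hω.2))
    have hle (x y z) := sub_le_mul_log_div
      (condProb_nonneg P {ω | f ω = x ∧ g ω = y} {ω | h ω = z}) (hs x y z) (hps x y z)
    -- Both distributions on `X × Y` have total mass one, so the lower bounds sum to zero.
    have hzero (z) (hz : 0 < prob P {ω | h ω = z}) :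
        ∑ x, ∑ y, (condProb P {ω | f ω = x ∧ g ω = y} {ω | h ω = z} -
          condProb P {ω | f ω = x} {ω | h ω = z} * condProb P {ω | g ω = y} {ω | h ω = z}) = 0 := by
      have h1 := sum_condProb_eq_one P (fun ω ↦ (f ω, g ω)) hz
      rw [Fintype.sum_prod_type] at h1
      simp only [Prod.mk.injEq] at h1
      simp only [sum_sub_distrib, ← mul_sum, sum_condProb_eq_one P _ hz, h1, mul_one, sub_self]
    refine sum_pos' (fun z _ ↦ ?_) ⟨z₀, mem_univ _, mul_pos hz₀ ?_⟩
    · rcases (prob_nonneg P {ω | h ω = z}).eq_or_lt' with h0 | h0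
      · simp [h0]
      · refine mul_nonneg h0.le ((hzero z h0).ge.trans ?_)
        exact sum_le_sum fun x _ ↦ sum_le_sum fun y _ ↦ hle x y z
    · refine (hzero z₀ hz₀).ge.trans_lt ?_
      refine sum_lt_sum (fun x _ ↦ sum_le_sum fun y _ ↦ hle x y z₀) ⟨x₀, mem_univ _, ?_⟩
      refine sum_lt_sum (fun y _ ↦ hle x₀ y z₀) ⟨y₀, mem_univ _, ?_⟩
      exact sub_lt_mul_log_div (condProb_nonneg P _ _) (hs _ _ _) (hps _ _ _) hne

end DiscreteProb

namespace BayesNet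

variable {V : Type*} {α : V → Type*}

/-! ### Strong relevance -/

lemma restrict_eq_restrict_iff {S : Finset V} {ω ω' : (v : V) → α v} :
    S.restrict ω' = S.restrict ω ↔ ∀ v ∈ S, ω' v = ω v := by
  simp [funext_iff]

lemma stronglyRelevant_iff [Fintype V] [DecidableEq V] (P : PMF ((v : V) → α v)) {C i : V}
    (hi : i ∈ features C) :
    StronglyRelevant P C i ↔ ¬ CondIndep P (fun ω ↦ ω i) (fun ω ↦ ω C)
      (((features C).erase i).restrict (π := α)) := by
  have hset (ω₀ : (v : V) → α v) : {ω | (features C).restrict ω = (features C).restrict ω₀} =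
      {ω | ω i = ω₀ i ∧
        ((features C).erase i).restrict ω = ((features C).erase i).restrict ω₀} := by
    ext ω
    simp only [Set.mem_ofPred_eq, restrict_eq_restrict_iff, mem_erase]
    grind
  -- For a fixed assignment of positive probability, the two conditional probabilities agree
  -- exactly if the product identity holds there.
  have key (ω₀ : (v : V) → α v) (c : α C)
      (h0 : 0 < prob P {ω | (features C).restrict ω = (features C).restrict ω₀}) :
      condProb P {ω | ω C = c} {ω | (features C).restrict ω = (features C).restrict ω₀} =
        condProb P {ω | ω C = c}
        {ω | ((features C).erase i).restrict ω = ((features C).erase i).restrict ω₀} ↔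
      prob P {ω | ω i = ω₀ i ∧ ω C = c ∧
          ((features C).erase i).restrict ω = ((features C).erase i).restrict ω₀} *
        prob P {ω | ((features C).erase i).restrict ω = ((features C).erase i).restrict ω₀} =
      prob P {ω | ω i = ω₀ i ∧
          ((features C).erase i).restrict ω = ((features C).erase i).restrict ω₀} *
        prob P {ω | ω C = c ∧
          ((features C).erase i).restrict ω = ((features C).erase i).restrict ω₀} := by
    rw [hset] at h0 ⊢
    have h1 := h0.trans_le (prob_mono P (D := {ω | ((features C).erase i).restrict ω =
      ((features C).erase i).restrict ω₀}) fun ω hω ↦ hω.2)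
    unfold condProb
    rw [div_eq_div_iff h0.ne' h1.ne', ← Set.ofPred_and, ← Set.ofPred_and]
    have e : {ω : (v : V) → α v | ω C = c ∧ ω i = ω₀ i ∧
        ((features C).erase i).restrict ω = ((features C).erase i).restrict ω₀} =
        {ω | ω i = ω₀ i ∧ ω C = c ∧
          ((features C).erase i).restrict ω = ((features C).erase i).restrict ω₀} := by
      ext ω; exact and_left_comm
    rw [e, mul_comm (prob P {ω | ω C = c ∧ _})]
  rw [condIndep_iff]
  constructor
  · rintro ⟨f, c, hf, hne⟩ hci
    obtain ⟨ω₀, rfl⟩ := nonempty_of_prob_pos hf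
    exact hne ((key ω₀ c hf).2 (hci _ _ _))
  · intro hci
    push Not at hci
    obtain ⟨x, y, z, hne⟩ := hci
    rcases (prob_nonneg P {ω | ω i = x ∧ ((features C).erase i).restrict ω = z}).eq_or_lt'
      with h0 | h0
    · refine absurd ?_ hne
      have h1 : prob P {ω | ω i = x ∧ ω C = y ∧ ((features C).erase i).restrict ω = z} = 0 :=
        prob_eq_zero_of_subset P (D := {ω | ω i = x ∧ _}) (fun ω hω ↦ ⟨hω.1, hω.2.2⟩) h0
      rw [h0, zero_mul, h1, zero_mul]
    · obtain ⟨ω₀, rfl, rfl⟩ := nonempty_of_prob_pos h0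
      have h1 : 0 < prob P {ω | (features C).restrict ω = (features C).restrict ω₀} := by
        rwa [hset]
      exact ⟨(features C).restrict ω₀, y, h1, fun he ↦ hne ((key ω₀ y h1).1 he)⟩

/-! ### Factorization and the Markov blanket -/

lemma mem_markovBlanket [Fintype V] {G : Digraph V} {C i : V} :
    i ∈ markovBlanket G C ↔ G.Adj i C ∨ G.Adj C i ∨ i ≠ C ∧ ∃ w, G.Adj C w ∧ G.Adj i w := by
  have h : i ∈ spouses G C ↔ i ≠ C ∧ ∃ w, G.Adj C w ∧ G.Adj i w := by
    classical
    unfold spouses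
    rw [mem_filter]
    simp [children]
  simp only [markovBlanket, mem_union, h, or_assoc]
  simp [parents, children]

lemma IsAcyclic.exists_sink [Finite V] {G : Digraph V} (hG : IsAcyclic G) {A : Finset V}
    (hA : A.Nonempty) : ∃ v ∈ A, ∀ w ∈ A, ¬ G.Adj v w := by
  have : IsTrans V fun a b ↦ Relation.TransGen G.Adj b a := ⟨fun _ _ _ h h' ↦ h'.trans h⟩
  have : Std.Irrefl fun a b ↦ Relation.TransGen G.Adj b a := ⟨hG⟩
  obtain ⟨v, hv, h⟩ := (Finite.wellFounded_of_trans_of_irrefl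
    fun a b ↦ Relation.TransGen G.Adj b a).has_min (A : Set V) hA
  exact ⟨v, hv, fun w hw hvw ↦ h w hw (.single hvw)⟩

/-- The Markov condition factorizes the marginal of every ancestral set `A` of nodes: peel off a
sink `v` of `A`, all of whose companions in `A` are non-descendants. Factors with a null
conditioning event are `0 / 0 = 0`, which is right since then the left-hand side vanishes too. -/
lemma MarkovCondition.prob_eq_prod [Fintype V] {G : Digraph V} (hG : IsAcyclic G)
    {P : PMF ((v : V) → α v)} (hP : MarkovCondition G P) (ω₀ : (v : V) → α v) (A : Finset V)
    (hA : ∀ u v, G.Adj u v → v ∈ A → u ∈ A) :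
    prob P {ω | ∀ v ∈ A, ω v = ω₀ v} =
      ∏ v ∈ A, condProb P {ω | ω v = ω₀ v} {ω | ∀ u, G.Adj u v → ω u = ω₀ u} := by
  classical
  induction A using Finset.strongInduction with
  | H A ih =>
  rcases A.eq_empty_or_nonempty with rfl | hne
  · simp [prob_univ]
  obtain ⟨v, hv, hsink⟩ := hG.exists_sink hne
  have hdesc (w : V) (hw : w ∈ A) : ¬ IsDescendant G v w := by
    intro h
    have hback (a) (h : Relation.TransGen G.Adj v a) (ha : a ∈ A) : False := by
      induction h with
      | single h => exact hsink _ ha h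
      | tail _ h ih' => exact ih' (hA _ _ h ha)
    exact hback w h hw
  have hpar (u : V) (hu : G.Adj u v) : u ∈ A.erase v :=
    mem_erase.2 ⟨by rintro rfl; exact hG _ (.single hu), hA u v hu hv⟩
  have hci := hP v (A.erase v)
    fun w hw ↦ ⟨ne_of_mem_erase hw, hdesc w (mem_of_mem_erase hw)⟩
  rw [condIndep_iff] at hci
  have hci := hci (ω₀ v) ((A.erase v).restrict ω₀) ((parents G v).restrict ω₀)
  simp only [restrict_eq_restrict_iff, parents, mem_filter, mem_univ, true_and] at hci
  have e1 : {ω : (v : V) → α v | ω v = ω₀ v ∧ (∀ w ∈ A.erase v, ω w = ω₀ w) ∧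
      ∀ u, G.Adj u v → ω u = ω₀ u} = {ω | ∀ w ∈ A, ω w = ω₀ w} := by
    ext ω; simp only [Set.mem_ofPred_eq]; grind
  have e2 : {ω : (v : V) → α v | (∀ w ∈ A.erase v, ω w = ω₀ w) ∧
      ∀ u, G.Adj u v → ω u = ω₀ u} = {ω | ∀ w ∈ A.erase v, ω w = ω₀ w} := by
    ext ω; simp only [Set.mem_ofPred_eq]; grind
  rw [e1, e2] at hci
  rw [← mul_prod_erase A _ hv, ← ih _ (erase_ssubset hv)
    fun a b hab hb ↦ mem_erase.2 ⟨by rintro rfl; exact hsink b (mem_of_mem_erase hb) hab,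
      hA a b hab (mem_of_mem_erase hb)⟩]
  unfold condProb
  rw [← Set.ofPred_and]
  rcases (prob_nonneg P {ω | ∀ u, G.Adj u v → ω u = ω₀ u}).eq_or_lt' with h0 | h0
  · rw [h0, div_zero, zero_mul]
    exact prob_eq_zero_of_subset P (fun ω hω u hu ↦ hω u (mem_of_mem_erase (hpar u hu))) h0
  · field_simp
    exact hci

/-- A node outside the Markov blanket of `C` is independent of `C` given all other nodes: no
factor of the joint distribution involves both. -/
lemma MarkovCondition.condIndep_of_notMem_markovBlanket [Fintype V] [DecidableEq V]
    [∀ v, Fintype (α v)] {G : Digraph V} (hG : IsAcyclic G)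
    {P : PMF ((v : V) → α v)} (hP : MarkovCondition G P) {C i : V} (hi : i ≠ C)
    (hmb : i ∉ markovBlanket G C) :
    CondIndep P (fun ω ↦ ω i) (fun ω ↦ ω C)
      (((features C).erase i).restrict (π := α)) := by
  classical
  rw [mem_markovBlanket] at hmb
  push Not at hmb
  obtain ⟨hiC, hCi, hsp⟩ := hmb
  rw [condIndep_iff]
  intro x y z
  rcases (prob_nonneg P {ω | ((features C).erase i).restrict ω = z}).eq_or_lt' with h0 | h0
  · rw [h0, mul_zero, prob_eq_zero_of_subset P (fun ω hω ↦ hω.2) h0, zero_mul]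
  obtain ⟨ω₀, rfl⟩ := nonempty_of_prob_pos h0
  set k : V → ((v : V) → α v) → ℝ := fun v ω₁ ↦
    condProb P {ω | ω v = ω₁ v} {ω | ∀ u, G.Adj u v → ω u = ω₁ u} with hk
  have hkcongr (v) (ω₁ ω₂ : (v : V) → α v) (hv : ω₁ v = ω₂ v)
      (hp : ∀ u, G.Adj u v → ω₁ u = ω₂ u) : k v ω₁ = k v ω₂ := by
    simp only [hk, hv]
    congr 1
    ext ω
    exact forall₂_congr fun u hu ↦ by rw [hp u hu]
  -- The factors involving `C`, and the others.
  set a : α C → ℝ := fun y ↦ ∏ v with v = C ∨ G.Adj C v, k v (Function.update ω₀ C y)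
  set b : α i → ℝ := fun x ↦ ∏ v with ¬ (v = C ∨ G.Adj C v), k v (Function.update ω₀ i x)
  set R : Set ((v : V) → α v) :=
    {ω | ((features C).erase i).restrict ω = ((features C).erase i).restrict ω₀}
  have hjoint (x y) : prob P ({ω | ω i = x} ∩ ({ω | ω C = y} ∩ R)) = b x * a y := by
    have e : {ω : (v : V) → α v | ω i = x} ∩ ({ω | ω C = y} ∩ R) =
        {ω | ∀ v ∈ (univ : Finset V),
          ω v = Function.update (Function.update ω₀ i x) C y v} := by
      ext ω
      simp only [R, Set.mem_inter_iff, Set.mem_ofPred_eq, restrict_eq_restrict_iff, mem_erase,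
        features, mem_univ, and_true, forall_const]
      constructor
      · rintro ⟨h1, h2, h3⟩ v
        by_cases hvC : v = C
        · subst hvC; simpa using h2
        · by_cases hvi : v = i
          · subst hvi; simpa [hvC] using h1
          · simpa [hvC, hvi] using h3 v ⟨hvi, hvC⟩
      · intro h
        refine ⟨by simpa [hi] using h i, by simpa using h C, fun v hv ↦ ?_⟩
        simpa [hv.1, hv.2] using h v
    rw [e, hP.prob_eq_prod hG _ univ fun _ _ _ _ ↦ mem_univ _, mul_comm,
      ← prod_filter_mul_prod_filter_not univ fun v ↦ v = C ∨ G.Adj C v]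
    congr 1
    · refine prod_congr rfl fun v hv ↦ hkcongr v _ _ ?_ fun u hu ↦ ?_
      · have : v ≠ i := by rintro rfl; simp_all
        by_cases hvC : v = C
        · subst hvC; simp
        · simp [hvC, this]
      · have : u ≠ i := by
          rintro rfl
          rcases (mem_filter.1 hv).2 with rfl | h
          · exact hiC hu
          · exact hsp hi v h hu
        by_cases hvC : u = C
        · subst hvC; simp
        · simp [hvC, this]
    · refine prod_congr rfl fun v hv ↦ hkcongr v _ _ ?_ fun u hu ↦ ?_
      · simp only [mem_filter, not_or] at hv
        simp [hv.2.1]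
      · have : u ≠ C := by rintro rfl; simp_all
        simp [this]
  have hC (y) : prob P ({ω | ω C = y} ∩ R) = (∑ x, b x) * a y := by
    rw [prob_eq_sum_inter P (fun ω ↦ ω i), sum_mul]
    exact sum_congr rfl fun x _ ↦ hjoint x y
  have hI (x) : prob P ({ω | ω i = x} ∩ R) = b x * ∑ y, a y := by
    rw [prob_eq_sum_inter P (fun ω ↦ ω C), mul_sum]
    refine sum_congr rfl fun y _ ↦ ?_
    rw [Set.inter_left_comm, hjoint]
  have hR : prob P R = (∑ x, b x) * ∑ y, a y := by
    rw [prob_eq_sum_inter P (fun ω ↦ ω C), mul_sum]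
    exact sum_congr rfl fun y _ ↦ hC y
  calc _ = prob P ({ω | ω i = x} ∩ ({ω | ω C = y} ∩ R)) * prob P R := rfl
    _ = prob P ({ω | ω i = x} ∩ R) * prob P ({ω | ω C = y} ∩ R) := by
      rw [hjoint, hR, hC, hI]; ring

/-! ### Dependence inside the Markov blanket -/

/-- A network over `Bool` driven by two fair coins refutes an entailed independence of `i` and `j`
given `S` if `i` and `j` must agree once `S` is all `false`, while each value remains possible. -/
lemma not_entails_of_coins [Fintype V] {G : Digraph V} {i j : V} {S : Finset V}
    (φ : Bool × Bool → V → Bool)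
    (hφ : MarkovCondition G ((PMF.uniformOfFintype (Bool × Bool)).map φ))
    (heq : ∀ p, (∀ v ∈ S, φ p v = false) → φ p i = φ p j)
    (htrue : φ (true, true) i = true) (hfalse : φ (false, false) j = false)
    (hS : ∀ v ∈ S, φ (true, true) v = false ∧ φ (false, false) v = false) :
    ¬ Entails G i j S := by
  intro h
  have hci := h (fun _ ↦ Bool) _ hφ
  rw [condIndep_iff] at hci
  have hci := hci true false (S.restrict fun _ ↦ false)
  simp only [restrict_eq_restrict_iff, prob_map] at hci
  have hpos (E : Set (Bool × Bool)) (p : Bool × Bool) (hp : p ∈ E) :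
      0 < prob (PMF.uniformOfFintype (Bool × Bool)) E := by
    refine lt_of_lt_of_le ?_ (prob_mono _ (Set.singleton_subset_iff.2 hp))
    simp [prob]
  have h0 : φ ⁻¹' {ω | ω i = true ∧ ω j = false ∧ ∀ v ∈ S, ω v = false} = ∅ := by
    ext p
    simp only [Set.mem_preimage, Set.mem_ofPred_eq, Set.mem_empty_iff_false, iff_false]
    rintro ⟨h1, h2, h3⟩
    simp [heq p h3, h2] at h1
  have h1 := hpos (φ ⁻¹' {ω | ω i = true ∧ ∀ v ∈ S, ω v = false}) (true, true)
    ⟨htrue, fun v hv ↦ (hS v hv).1⟩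
  have h2 := hpos (φ ⁻¹' {ω | ω j = false ∧ ∀ v ∈ S, ω v = false}) (false, false)
    ⟨hfalse, fun v hv ↦ (hS v hv).2⟩
  rw [h0] at hci
  have h3 := (mul_pos h1 h2).ne'
  rw [← hci] at h3
  simp [prob] at h3

lemma prob_uniform_coins (E : Set (Bool × Bool)) [DecidablePred (· ∈ E)] :
    prob (PMF.uniformOfFintype (Bool × Bool)) E = #{p | p ∈ E} / 4 := by
  rw [prob, PMF.toOuterMeasure_uniformOfFintype_apply, ENNReal.toReal_div]
  simp [Fintype.card_subtype]

lemma coins_indep (x y : Bool) :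
    prob (PMF.uniformOfFintype (Bool × Bool)) {p | p.1 = x ∧ p.2 = y} =
      prob (PMF.uniformOfFintype (Bool × Bool)) {p | p.1 = x} *
        prob (PMF.uniformOfFintype (Bool × Bool)) {p | p.2 = y} := by
  have e1 : ∀ x y : Bool, #{p : Bool × Bool | p.1 = x ∧ p.2 = y} = 1 := by decide
  have e2 : ∀ x : Bool, #{p : Bool × Bool | p.1 = x} = 2 := by decide
  have e3 : ∀ y : Bool, #{p : Bool × Bool | p.2 = y} = 2 := by decide
  simp only [prob_uniform_coins, Set.mem_ofPred_eq, e1, e2, e3]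
  norm_num

/-- Dependence along an edge `a → b`: all nodes are constant except that `b` copies a fair
coin `a`. -/
lemma markovCondition_copy [Fintype V] [DecidableEq V] {G : Digraph V} (hG : IsAcyclic G)
    {a b : V} (hab : G.Adj a b) :
    MarkovCondition G ((PMF.uniformOfFintype (Bool × Bool)).map
      fun p (v : V) ↦ if v = a ∨ v = b then p.1 else false) := by
  intro v S hS
  rw [condIndep_map]
  by_cases hva : v = a
  · subst hva
    have hSb (w) (hw : w ∈ S) : ¬ (w = v ∨ w = b) := by
      rintro (rfl | rfl)
      · exact (hS w hw).1 rfl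
      · exact (hS w hw).2 (.single hab)
    have hpb (u) (hu : u ∈ parents G v) : ¬ (u = v ∨ u = b) := by
      have hu : G.Adj u v := by simpa [parents] using hu
      rintro (rfl | rfl)
      · exact hG _ (.single hu)
      · exact hG _ (.tail (.single hu) hab)
    -- Neither the non-descendants nor the parents of the source of the edge vary.
    refine condIndep_of_indep _ (fun _ ↦ ()) (fun x y ↦ ?_)
      (fun _ _ ↦ false) (fun p ↦ ?_) (fun _ _ ↦ false) (fun p ↦ ?_)
    · simp [prob_univ]
    · ext u; simp [hSb u u.2]
    · ext u; simp [hpb u u.2]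
  by_cases hvb : v = b
  · subst hvb
    refine condIndep_of_comp _ _ (fun z ↦ z ⟨a, by simpa [parents] using hab⟩) fun p ↦ ?_
    simp
  · exact condIndep_of_comp _ _ (fun _ ↦ false) fun p ↦ by simp [hva, hvb]

/-- Dependence of the two parents of a collider `a → w ← b`: all nodes are constant except that
`a` and `b` are independent fair coins and `w` is their exclusive or. -/
lemma markovCondition_xor [Fintype V] [DecidableEq V] {G : Digraph V} (hG : IsAcyclic G)
    {a b w : V} (hab : a ≠ b) (haw : G.Adj a w) (hbw : G.Adj b w) :
    MarkovCondition G ((PMF.uniformOfFintype (Bool × Bool)).map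
      fun p (v : V) ↦ if v = a then p.1 else if v = b then p.2 else
        if v = w then xor p.1 p.2 else false) := by
  have hne {u v : V} (h : G.Adj u v) : u ≠ v := by rintro rfl; exact hG _ (.single h)
  have haw' := hne haw
  have hbw' := hne hbw
  intro v S hS
  rw [condIndep_map]
  have hSw (hvw : G.Adj v w) (u) (hu : u ∈ S) : u ≠ v ∧ u ≠ w :=
    ⟨(hS u hu).1, by rintro rfl; exact (hS u hu).2 (.single hvw)⟩
  -- A node with an edge into `w` has no edge from `w`.
  have hpw (hvw : G.Adj v w) (u) (hu : u ∈ parents G v) : u ≠ v ∧ u ≠ w := by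
    have hu : G.Adj u v := by simpa [parents] using hu
    exact ⟨hne hu, by rintro rfl; exact hG _ (.tail (.single hu) hvw)⟩
  by_cases hva : v = a
  · subst hva
    refine condIndep_of_indep _ (fun p ↦ p.2) (fun x y ↦ ?_)
      (fun y u ↦ if u.1 = b then y else false) (fun p ↦ ?_)
      (fun y u ↦ if u.1 = b then y else false) (fun p ↦ ?_)
    · simpa using coins_indep x y
    · ext u; simp [hSw haw u u.2]
    · ext u; simp [hpw haw u u.2]
  by_cases hvb : v = b
  · subst hvb
    refine condIndep_of_indep _ (fun p ↦ p.1) (fun x y ↦ ?_)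
      (fun y u ↦ if u.1 = a then y else false) (fun p ↦ ?_)
      (fun y u ↦ if u.1 = a then y else false) (fun p ↦ ?_)
    · simpa [hva, and_comm, mul_comm] using coins_indep y x
    · ext u; simp [hSw hbw u u.2]
    · ext u; simp [hpw hbw u u.2]
  by_cases hvw : v = w
  · subst hvw
    refine condIndep_of_comp _ _ (fun z ↦ xor (z ⟨a, by simpa [parents] using haw⟩)
      (z ⟨b, by simpa [parents] using hbw⟩)) fun p ↦ ?_
    simp [hva, hvb, hab.symm]
  · exact condIndep_of_comp _ _ (fun _ ↦ false) fun p ↦ by simp [hva, hvb, hvw]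

lemma not_entails_of_mem_markovBlanket [Fintype V] [DecidableEq V] {G : Digraph V}
    (hG : IsAcyclic G) {i C : V} (hi : i ∈ markovBlanket G C) :
    ¬ Entails G i C ((features C).erase i) := by
  have hedge {a b : V} (hab : G.Adj a b) (h : a = i ∧ b = C ∨ a = C ∧ b = i) :
      ¬ Entails G i C ((features C).erase i) := by
    refine not_entails_of_coins _ (markovCondition_copy hG hab) ?_ ?_ ?_ ?_
    all_goals simp only [features, mem_erase]; grind
  rcases mem_markovBlanket.1 hi with h | h | ⟨hne, w, hCw, hiw⟩
  · exact hedge h (.inl ⟨rfl, rfl⟩)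
  · exact hedge h (.inr ⟨rfl, rfl⟩)
  · have hwi : w ≠ i := by rintro rfl; exact hG _ (.single hiw)
    have hwC : w ≠ C := by rintro rfl; exact hG _ (.single hCw)
    refine not_entails_of_coins _ (markovCondition_xor hG hne hiw hCw) (fun p hp ↦ ?_) ?_ ?_ ?_
    · have := hp w (by simp [features, hwi, hwC])
      simpa [hwi, hwC, hne.symm] using this
    all_goals simp only [features, mem_erase]; grind

end BayesNet

theorem corollary1 {V : Type*} [Fintype V] [DecidableEq V] {α : V → Type*} [∀ v, Fintype (α v)]
    (B : BayesNet.BayesianNetwork V α) (hB : B.Faithful) (C : V) :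
    (∀ i ∈ BayesNet.features C,
      i ∈ BayesNet.markovBlanket B.graph C ↔ BayesNet.StronglyRelevant B.dist C i) ∧
    (∀ i ∈ BayesNet.features C,
      BayesNet.StronglyRelevant B.dist C i ↔ 0 < BayesNet.featureInfo B.dist C i) ∧
    (BayesNet.markovBlanket B.graph C : Set V) =
      {i | i ∈ BayesNet.features C ∧ BayesNet.StronglyRelevant B.dist C i} := by
  have hmb (i) (hi : i ∈ features C) :
      i ∈ markovBlanket B.graph C ↔ StronglyRelevant B.dist C i := by
    have hne : i ≠ C := ne_of_mem_erase hi
    rw [stronglyRelevant_iff B.dist hi]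
    refine ⟨fun h hci ↦ not_entails_of_mem_markovBlanket B.acyclic h
      (hB i C _ hne (notMem_erase _ _) (by simp [features]) hci), fun h ↦ ?_⟩
    by_contra hn
    exact h (B.markov.condIndep_of_notMem_markovBlanket B.acyclic hne hn)
  refine ⟨hmb, fun i hi ↦ ?_, ?_⟩
  · rw [stronglyRelevant_iff B.dist hi, featureInfo, condMutualInfo_pos_iff]
  · ext i
    refine ⟨fun h ↦ ?_, fun h ↦ (hmb i h.1).2 h.2⟩
    have hi : i ∈ features C := by
      refine mem_erase.2 ⟨?_, mem_univ i⟩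
      rintro rfl
      rcases mem_markovBlanket.1 h with h | h | h
      · exact B.acyclic _ (.single h)
      · exact B.acyclic _ (.single h)
      · exact h.1 rfl
    exact ⟨hi, (hmb i hi).1 h⟩
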